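/- Let $n\ge 1$ and let $B_n$ be the hyperoctahedral group: all bijections $\sigma$ of $\{-n,\dots,-1,1,\dots,n\}$ onto itself with $\sigma(-a)=-\sigma(a)$, under composition. It is generated by $s_0,s_1,\dots,s_{n-1}$, where $s_0$ exchanges $1$ and $-1$, and $s_i$ for $1\le i\le n-1$ exchanges $i$ with $i+1$ and $-i$ with $-(i+1)$; let $\ell(\sigma)$ be the length of $\sigma$ with respect to these generators, i.e. the least number of factors in an expression of $\sigma$ as a product of them. Let $\mathrm{neg}(\sigma)=\#\{1\le i\le n : \sigma(i)<0\}$, let $\mathrm{maj}(\sigma)$ be the sum of all $i\in\{1,\dots,n-1\}$ such that $\sigma(i)$ is greater than $\sigma(i+1)$ in the order $-1<-2<\cdots<-n<1<2<\cdots<n$, and let $\mathrm{fmaj}(\sigma)=2\,\mathrm{maj}(\sigma)+\mathrm{neg}(\sigma)$ be the flag-major index. Let $|\sigma|\in S_n$ be the permutation $(|\sigma(1)|,\dots,|\sigma(n)|)$, and let $[m]_q=\frac{1-q^m}{1-q}$. Consider the subgroups $$B_n^+=\{\sigma\in B_n : \ell(\sigma)\text{ even}\},\qquad D_n=\{\sigma\in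 B_n : \mathrm{neg}(\sigma)\text{ even}\},\qquad C_2\wr A_n=\{\sigma\in B_n : |\sigma|\text{ is an even permutation}\}.$$ Then, as identities of rational functions over $\mathbb{Q}$ in the indeterminate $q$, $$\sum_{\sigma\in B_n^+} q^{\mathrm{fmaj}(\sigma)}=\tfrac12\Bigl(\prod_{i=1}^n[2i]_q+\prod_{i=1}^n[2i]_{(-1)^i q}\Bigr),\tag{1}$$ $$\sum_{\sigma\in D_n} q^{\mathrm{fmaj}(\sigma)}=\tfrac12\Bigl(\prod_{i=1}^n[2i]_q+\prod_{i=1}^n[2i]_{-q}\Bigr),\tag{2}$$ $$\sum_{\sigma\in C_2\wr A_n} q^{\mathrm{fmaj}(\sigma)}=\tfrac12\Bigl(\prod_{i=1}^n[2i]_q+\prod_{i=1}^n[2i]_{(-1)^{i-1} q}\Bigr).\tag{3}$$ -/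

import Mathlib

/-- The set `[-n, n] \ {0}` of integers. -/
abbrev SignedRange (n : ℕ) : Type := {a : ℤ // a ∈ (Finset.Icc (-(n : ℤ)) n).erase 0}

namespace SignedRange

variable {n : ℕ}

instance : Neg (SignedRange n) :=
  ⟨fun a => ⟨-a.1, by
    have h := a.2
    simp only [Finset.mem_erase, Finset.mem_Icc] at h ⊢
    omega⟩⟩

/-- The positive letter `i + 1`, for `i = 0, …, n - 1`. -/
def pos (i : Fin n) : SignedRange n :=
  ⟨(i : ℤ) + 1, by
    have h := i.2
    simp only [Finset.mem_erase, Finset.mem_Icc]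
    omega⟩

/-- The absolute value of a letter, as an element of `Fin n` (shifted by one: `idx a = |a| - 1`). -/
def idx (a : SignedRange n) : Fin n :=
  ⟨a.1.natAbs - 1, by
    have h := a.2
    simp only [Finset.mem_erase, Finset.mem_Icc] at h
    omega⟩

/-- The sign of a letter. -/
def sgn (a : SignedRange n) : ℤˣ := if a.1 < 0 then -1 else 1

theorem bounds (a : SignedRange n) : a.1 ≠ 0 ∧ -(n : ℤ) ≤ a.1 ∧ a.1 ≤ n := by
  have h := a.2
  simp only [Finset.mem_erase, Finset.mem_Icc] at h
  exact h

@[simp] theorem neg_val (a : SignedRange n) : (-a).1 = -a.1 := rfl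
@[simp] theorem pos_val (i : Fin n) : (pos i).1 = (i : ℤ) + 1 := rfl
@[simp] theorem neg_neg' (a : SignedRange n) : -(-a) = a := Subtype.ext (by simp)

@[simp] theorem idx_pos (i : Fin n) : idx (pos i) = i := by
  apply Fin.ext
  simp only [idx, pos_val]
  omega

@[simp] theorem idx_neg (a : SignedRange n) : idx (-a) = idx a := by
  apply Fin.ext
  simp [idx]

theorem eq_pos_or (a : SignedRange n) :
    (a = pos (idx a) ∧ 0 < a.1) ∨ (a = -pos (idx a) ∧ a.1 < 0) := by
  have h := a.bounds
  rcases lt_or_gt_of_ne h.1 with h0 | h0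
  · right
    refine ⟨Subtype.ext ?_, h0⟩
    simp only [idx, neg_val, pos_val]
    omega
  · left
    refine ⟨Subtype.ext ?_, h0⟩
    simp only [idx, pos_val]
    omega

theorem sgn_neg (a : SignedRange n) : sgn (-a) = -sgn a := by
  have h := a.bounds
  rcases lt_or_gt_of_ne h.1 with h0 | h0
  · simp [sgn, h0, h0.le]
  · simp [sgn, h0, not_lt.2 h0.le]

@[simp] theorem sgn_pos (i : Fin n) : sgn (pos i) = 1 := by
  have : ¬ ((i : ℤ) + 1 < 0) := by omega
  simp [sgn, this]

end SignedRange

open SignedRange in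
/-- The hyperoctahedral group `B_n`: all bijections `σ` of `[-n, n] \ {0}` onto itself with
`σ (-a) = -σ a`, under composition. -/
def hyperoctahedral (n : ℕ) : Subgroup (Equiv.Perm (SignedRange n)) where
  carrier := {σ | ∀ a, σ (-a) = -σ a}
  one_mem' := fun _ => rfl
  mul_mem' := by
    intro σ τ hσ hτ a
    rw [Equiv.Perm.mul_apply, Equiv.Perm.mul_apply, hτ, hσ]
  inv_mem' := by
    intro σ hσ a
    rw [Equiv.Perm.inv_eq_iff_eq, hσ]
    simp

namespace hyperoctahedral

open SignedRange

variable {n : ℕ}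

theorem map_neg (σ : hyperoctahedral n) (a : SignedRange n) : σ.1 (-a) = -σ.1 a := σ.2 a

/-- The entry `σ(i + 1)` of the sequence `(σ(1), …, σ(n))`, for `i = 0, …, n - 1`. -/
def entry (σ : hyperoctahedral n) (i : Fin n) : ℤ := (σ.1 (pos i)).1

/-- `neg(σ)`, the number of `1 ≤ i ≤ n` with `σ(i) < 0`. -/
def neg (σ : hyperoctahedral n) : ℕ :=
  (Finset.univ.filter fun i : Fin n => entry σ i < 0).card

/-- The strict order `-1 < ⋯ < -n < 1 < ⋯ < n` on nonzero integers. -/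
def flagLT (a b : ℤ) : Prop :=
  (a < 0 ∧ 0 < b) ∨ (0 < a ∧ a < b) ∨ (b < a ∧ a < 0)

instance : DecidableRel flagLT := fun a b =>
  inferInstanceAs (Decidable ((a < 0 ∧ 0 < b) ∨ (0 < a ∧ a < b) ∨ (b < a ∧ a < 0)))

/-- The major index of `(σ(1), …, σ(n))` with respect to the order `-1 < ⋯ < -n < 1 < ⋯ < n`:
the sum of the positions `1 ≤ j ≤ n - 1` (here `j = i + 1`) such that `σ(j + 1)` is smaller
than `σ(j)`. -/
def maj (σ : hyperoctahedral n) : ℕ :=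
  ∑ i ∈ Finset.univ.filter (fun i : Fin n =>
      ∃ h : i.1 + 1 < n, flagLT (entry σ ⟨i.1 + 1, h⟩) (entry σ i)), (i.1 + 1)

/-- The flag-major index. -/
def flagMajor (σ : hyperoctahedral n) : ℕ := 2 * maj σ + neg σ

/-- The Coxeter generators `s_0, s_1, …, s_{n-1}` of `B_n`: `s_0 = [-1, 2, …, n]` exchanges
`1` and `-1`, and `s_i` for `1 ≤ i ≤ n - 1` exchanges `i` with `i + 1` and `-i` with `-(i + 1)`. -/
def gen (i : Fin n) : hyperoctahedral n :=
  if i.1 = 0 then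
    ⟨Equiv.swap (pos i) (-pos i), by
      intro a
      simp only [Equiv.swap_apply_def, Subtype.ext_iff, neg_val, pos_val]
      split_ifs <;> simp only [neg_val, pos_val] <;> omega⟩
  else
    ⟨Equiv.swap (pos ⟨i.1 - 1, by omega⟩) (pos i) *
        Equiv.swap (-pos ⟨i.1 - 1, by omega⟩) (-pos i), by
      intro a
      have ha := a.bounds
      simp only [Equiv.Perm.mul_apply, Equiv.swap_apply_def, Subtype.ext_iff, neg_val, pos_val]
      split_ifs <;> simp only [neg_val, pos_val] at * <;> omega⟩

/-- The length of `σ` with respect to the Coxeter generators: the least number of factors in an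
expression of `σ` as a product of generators. -/
noncomputable def length (σ : hyperoctahedral n) : ℕ :=
  sInf {k | ∃ w : List (Fin n), w.length = k ∧ (w.map gen).prod = σ}

theorem idx_apply (σ : hyperoctahedral n) (a : SignedRange n) :
    idx (σ.1 (pos (idx a))) = idx (σ.1 a) := by
  rcases eq_pos_or a with ⟨h, -⟩ | ⟨h, -⟩
  · rw [← h]
  · conv_rhs => rw [h, map_neg, idx_neg]

/-- The homomorphism `σ ↦ |σ| = (|σ(1)|, …, |σ(n)|)` from `B_n` to `S_n`, where `S_n` acts on
`Fin n = {0, …, n - 1}`. -/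
def absPerm : hyperoctahedral n →* Equiv.Perm (Fin n) where
  toFun σ :=
    { toFun := fun i => idx (σ.1 (pos i))
      invFun := fun i => idx ((σ⁻¹).1 (pos i))
      left_inv := fun i => by
        change idx ((σ⁻¹).1 (pos (idx (σ.1 (pos i))))) = i
        rw [idx_apply]
        simp
      right_inv := fun i => by
        change idx (σ.1 (pos (idx ((σ⁻¹).1 (pos i))))) = i
        rw [idx_apply]
        simp }
  map_one' := by
    ext i
    simp
  map_mul' σ τ := by
    ext i
    simp [idx_apply]

theorem absPerm_apply (σ : hyperoctahedral n) (i : Fin n) :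
    absPerm σ i = idx (σ.1 (pos i)) := rfl

theorem neg_one_pow_neg (σ : hyperoctahedral n) :
    (-1 : ℤˣ) ^ neg σ = ∏ i, sgn (σ.1 (pos i)) := by
  simp only [sgn, Finset.prod_ite, Finset.prod_const, one_pow, mul_one]
  rfl

theorem sgn_apply (σ : hyperoctahedral n) (a : SignedRange n) :
    sgn (σ.1 a) = sgn a * sgn (σ.1 (pos (idx a))) := by
  rcases eq_pos_or a with ⟨h, -⟩ | ⟨h, -⟩
  · rw [← h]
    conv_rhs => rw [h]
    rw [sgn_pos, one_mul, ← h]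
  · conv_lhs => rw [h, map_neg, sgn_neg]
    conv_rhs => rw [h, idx_neg, idx_pos, sgn_neg, sgn_pos]
    simp

/-- The one-dimensional character `σ ↦ (-1) ^ neg(σ)`. -/
def negChar : hyperoctahedral n →* ℤˣ where
  toFun σ := (-1) ^ neg σ
  map_one' := by
    rw [neg_one_pow_neg]
    simp
  map_mul' σ τ := by
    simp only [neg_one_pow_neg]
    have h : ∀ i, sgn ((σ * τ).1 (pos i)) =
        sgn (τ.1 (pos i)) * sgn (σ.1 (pos (absPerm τ i))) := fun i => by
      rw [absPerm_apply, ← sgn_apply]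
      rfl
    rw [Finset.prod_congr rfl fun i _ => h i, Finset.prod_mul_distrib,
      Equiv.prod_comp (absPerm τ) fun i => sgn (σ.1 (pos i)), mul_comm]

theorem negChar_apply (σ : hyperoctahedral n) : negChar σ = (-1) ^ neg σ := rfl

theorem gen_apply_zero (i : Fin n) (hi : i.1 = 0) (j : Fin n) :
    (gen i).1 (pos j) = if j = i then -pos j else pos j := by
  simp only [gen, hi, if_true, Equiv.swap_apply_def, Subtype.ext_iff, neg_val, pos_val, Fin.ext_iff]
  split_ifs <;> simp only [neg_val, pos_val] <;> omega

theorem gen_apply_succ (i k : Fin n) (hi : i.1 = k.1 + 1) (j : Fin n) :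
    (gen i).1 (pos j) = pos (Equiv.swap k i j) := by
  have hk : (⟨i.1 - 1, by omega⟩ : Fin n) = k := Fin.ext (by simp [hi])
  have hi0 : i.1 ≠ 0 := by omega
  simp only [gen, hi0, if_false, hk, Equiv.Perm.mul_apply, Equiv.swap_apply_def, Subtype.ext_iff,
    neg_val, pos_val, Fin.ext_iff]
  split_ifs <;> (try simp only [pos_val] at *) <;> omega

theorem char_gen (i : Fin n) : Equiv.Perm.sign (absPerm (gen i)) * negChar (gen i) = -1 := by
  rw [negChar_apply, neg_one_pow_neg]
  by_cases hi : i.1 = 0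
  · have h1 : absPerm (gen i) = 1 := by
      apply Equiv.ext
      intro j
      rw [absPerm_apply, gen_apply_zero i hi]
      split_ifs <;> simp
    have h2 : ∀ j, sgn ((gen i).1 (pos j)) = if j = i then -1 else 1 := fun j => by
      rw [gen_apply_zero i hi]
      split_ifs <;> simp [sgn_neg]
    simp [h1, h2]
  · have hk : i.1 = (⟨i.1 - 1, by omega⟩ : Fin n).1 + 1 := by
      simp only
      omega
    have h1 : absPerm (gen i) = Equiv.swap ⟨i.1 - 1, by omega⟩ i := by
      apply Equiv.ext
      intro j
      rw [absPerm_apply, gen_apply_succ i _ hk, idx_pos]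
    have hne : (⟨i.1 - 1, by omega⟩ : Fin n) ≠ i := by
      intro h
      have := congrArg Fin.val h
      simp only at this
      omega
    rw [h1, Equiv.Perm.sign_swap hne]
    simp [gen_apply_succ i _ hk]

/-- An element whose sequence of entries is positive and increasing is the identity. -/
theorem eq_one_of_strictMono (σ : hyperoctahedral n) (h0 : ∀ i, 0 < entry σ i)
    (h1 : StrictMono (entry σ)) : σ = 1 := by
  have hval : ∀ i, σ.1 (pos i) = pos (absPerm σ i) := fun i => by
    rcases eq_pos_or (σ.1 (pos i)) with ⟨h, -⟩ | ⟨-, h⟩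
    · exact h
    · exact absurd h (not_lt.2 (h0 i).le)
  have hmono : StrictMono (absPerm σ) := fun i j hij => by
    have := h1 hij
    simp only [entry, hval, pos_val] at this
    rw [Fin.lt_def]
    omega
  have hid : ∀ i, absPerm σ i = i := fun i => by
    have := (StrictMono.orderIsoOfSurjective _ hmono (absPerm σ).surjective :
      Fin n ≃o Fin n)
    have e : StrictMono.orderIsoOfSurjective _ hmono (absPerm σ).surjective = OrderIso.refl _ :=
      Subsingleton.elim _ _
    exact congrArg (fun f : Fin n ≃o Fin n => f i) e
  apply Subtype.ext
  apply Equiv.ext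
  intro a
  rcases eq_pos_or a with ⟨h, -⟩ | ⟨h, -⟩
  · rw [h, hval, hid]
    rfl
  · rw [h, map_neg, hval, hid]
    rfl

/-- The elements `s_0, …, s_{n-1}` generate `B_n`. -/
theorem exists_word (σ : hyperoctahedral n) : ∃ w : List (Fin n), (w.map gen).prod = σ := by
  let F : hyperoctahedral n → ℤ := fun τ => ∑ i : Fin n, ((i : ℤ) + 1) * entry τ i
  have hne : Nonempty {p : hyperoctahedral n // ∃ w : List (Fin n), (w.map gen).prod = p} :=
    ⟨1, [], rfl⟩
  obtain ⟨⟨p, w, hw⟩, hp⟩ := Finite.exists_max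
    (fun p : {p : hyperoctahedral n // ∃ w : List (Fin n), (w.map gen).prod = p} => F (σ⁻¹ * p.1))
  set τ := σ⁻¹ * p with hτ
  have hmax : ∀ i, F (τ * gen i) ≤ F τ := fun i => by
    have := hp ⟨p * gen i, w ++ [i], by simp [hw]⟩
    simpa [hτ, mul_assoc] using this
  have hent : ∀ i j, entry (τ * gen i) j = (τ.1 ((gen i).1 (pos j))).1 := fun i j => rfl
  have hfirst : ∀ i : Fin n, i.1 = 0 → 0 < entry τ i := fun i hi => by
    have hF : F (τ * gen i) - F τ = -2 * entry τ i := by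
      simp only [F, ← Finset.sum_sub_distrib]
      rw [Finset.sum_eq_single i]
      · rw [hent, gen_apply_zero i hi, if_pos rfl, map_neg, neg_val, hi]
        simp only [entry]
        push_cast
        ring
      · intro j _ hj
        rw [hent, gen_apply_zero i hi, if_neg hj]
        simp [entry]
      · simp
    have h1 := hmax i
    have h2 : entry τ i ≠ 0 := (bounds _).1
    omega
  have hstep : ∀ i k : Fin n, i.1 = k.1 + 1 → entry τ k < entry τ i := fun i k hi => by
    have hki : k ≠ i := fun h => by
      rw [h] at hi
      omega
    have hF : F (τ * gen i) = ∑ j : Fin n, ((Equiv.swap k i j : ℤ) + 1) * entry τ j := by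
      rw [← Equiv.sum_comp (Equiv.swap k i)]
      simp only [F, hent, gen_apply_succ i k hi, Equiv.swap_apply_self]
      rfl
    have hF' : F (τ * gen i) - F τ = entry τ k - entry τ i := by
      rw [hF]
      simp only [F, ← Finset.sum_sub_distrib]
      rw [Finset.sum_eq_add k i hki]
      · rw [Equiv.swap_apply_left, Equiv.swap_apply_right, hi]
        push_cast
        ring
      · rintro j - ⟨h1, h2⟩
        rw [Equiv.swap_apply_of_ne_of_ne h1 h2]
        simp
      · simp
      · simp
    have h1 := hmax i
    have h2 : entry τ k ≠ entry τ i := fun h => by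
      have h3 := τ.1.injective (Subtype.ext h)
      have h4 := congrArg idx h3
      simp only [idx_pos] at h4
      exact hki h4
    omega
  have hmono : StrictMono (entry τ) := by
    cases n with
    | zero => exact fun i => i.elim0
    | succ m => exact Fin.strictMono_iff_lt_succ.2 fun i => hstep i.succ i.castSucc (by simp)
  have hpos : ∀ i, 0 < entry τ i := fun i =>
    lt_of_lt_of_le (hfirst ⟨0, i.pos⟩ rfl) (hmono.monotone (Fin.mk_le_of_le_val (Nat.zero_le _)))
  have h1 : τ = 1 := eq_one_of_strictMono τ hpos hmono
  rw [hτ, inv_mul_eq_one] at h1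
  exact ⟨w, by rw [hw, h1]⟩

/-- `sign(σ) = (-1) ^ ℓ(σ)` is the product of the characters `sign(|σ|)` and `(-1) ^ neg(σ)`. -/
theorem neg_one_pow_length (σ : hyperoctahedral n) :
    (-1 : ℤˣ) ^ length σ = Equiv.Perm.sign (absPerm σ) * negChar σ := by
  obtain ⟨w0, hw0⟩ := exists_word σ
  have hmem : length σ ∈ {k | ∃ w : List (Fin n), w.length = k ∧ (w.map gen).prod = σ} :=
    Nat.sInf_mem ⟨_, w0, rfl, hw0⟩
  obtain ⟨w, hw, hσ⟩ := hmem
  rw [← hw, ← hσ]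
  clear hw hσ
  induction w with
  | nil => simp
  | cons i w ih =>
    rw [List.length_cons, pow_succ', ih, List.map_cons, List.prod_cons, map_mul, map_mul, map_mul,
      mul_mul_mul_comm, char_gen]

theorem even_iff_neg_one_pow (k : ℕ) : Even k ↔ (-1 : ℤˣ) ^ k = 1 :=
  (neg_one_pow_eq_one_iff_even (by decide)).symm

/-- The subgroup `B_n^+` of even elements of `B_n`, those with `sign(σ) = (-1) ^ ℓ(σ) = 1`. -/
def evenSubgroup (n : ℕ) : Subgroup (hyperoctahedral n) where
  carrier := {σ | Even (length σ)}
  one_mem' := by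
    simp [even_iff_neg_one_pow, neg_one_pow_length]
  mul_mem' := by
    intro σ τ hσ hτ
    simp only [Set.mem_ofPred_eq, even_iff_neg_one_pow, neg_one_pow_length] at *
    rw [map_mul, map_mul, map_mul, mul_mul_mul_comm, hσ, hτ, mul_one]
  inv_mem' := by
    intro σ hσ
    simp only [Set.mem_ofPred_eq, even_iff_neg_one_pow, neg_one_pow_length] at *
    rw [map_inv, map_inv, map_inv, ← mul_inv, hσ, inv_one]

/-- The subgroup `D_n` of elements of `B_n` with even `neg`. -/
def typeD (n : ℕ) : Subgroup (hyperoctahedral n) where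
  carrier := {σ | Even (neg σ)}
  one_mem' := by
    simp [even_iff_neg_one_pow, ← negChar_apply]
  mul_mem' := by
    intro σ τ hσ hτ
    simp only [Set.mem_ofPred_eq, even_iff_neg_one_pow, ← negChar_apply] at *
    rw [map_mul, hσ, hτ, mul_one]
  inv_mem' := by
    intro σ hσ
    simp only [Set.mem_ofPred_eq, even_iff_neg_one_pow, ← negChar_apply] at *
    rw [map_inv, hσ, inv_one]

/-- The subgroup `C_2 ≀ A_n` of elements `σ` of `B_n` such that `|σ|` is an even permutation. -/
def wreathAlternating (n : ℕ) : Subgroup (hyperoctahedral n) :=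
  (alternatingGroup (Fin n)).comap absPerm

end hyperoctahedral

/-- `[m]_q = (1 - q ^ m) / (1 - q)`. -/
def qInt {K : Type*} [Field K] (m : ℕ) (q : K) : K := (1 - q ^ m) / (1 - q)

/-! Each of the three subgroups is the kernel of a character `χ` with values ±1, so its generating
function is the average of the sums of `q ^ fmaj` and `χ q ^ fmaj` over `B_n`. It remains to factor
the twisted sum for any `χ`. Write `c_m` for `flagCycle m`. Every element is uniquely
`c_{n-1}^{k_{n-1}} ⋯ c_0^{k_0}` with `0 ≤ k_m < 2(m+1)`, and its flag-major index is `k_0 + ⋯ +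
k_{n-1}`: each left factor `c_m` raises the index by one until it wraps around
(`FixesFrom.flagMajor_flagCycle_mul`). Since `χ` is multiplicative, the sum is the product of the
geometric sums of `(χ(c_m) q)^k` over `k < 2(m+1)`, that is, of `[2(m+1)]` at `χ(c_m) q`
(`sum_weight`). The signs follow from `sign |c_m| = (-1)^m` and `(-1)^neg(c_m) = -1`. -/

namespace hyperoctahedral

open SignedRange

variable {n : ℕ}

/-- Going one step down in the cyclic order `-1 < ⋯ < -(m + 1) < 1 < ⋯ < m + 1` on the letters
of absolute value at most `m + 1`; the other letters are fixed. -/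
def stepDown (m : ℕ) (a : ℤ) : ℤ :=
  if a = 1 then -(m + 1) else if a = -1 then m + 1 else
  if 1 < a ∧ a ≤ m + 1 then a - 1 else if a < -1 ∧ -(m + 1) ≤ a then a + 1 else a

/-- The inverse of `stepDown`. -/
def stepUp (m : ℕ) (a : ℤ) : ℤ :=
  if a = m + 1 then -1 else if a = -(m + 1) then 1 else
  if 0 < a ∧ a ≤ m then a + 1 else if a < 0 ∧ -m ≤ a then a - 1 else a

/-- The element `s_m ⋯ s_1 s_0` of `B_n`, acting on letters by `stepDown`. -/
def flagCycle (m : Fin n) : hyperoctahedral n :=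
  ⟨{ toFun := fun a => ⟨stepDown m a.1, by
        have := a.bounds
        have := m.2
        simp only [Finset.mem_erase, Finset.mem_Icc, stepDown]
        split_ifs <;> omega⟩
     invFun := fun a => ⟨stepUp m a.1, by
        have := a.bounds
        have := m.2
        simp only [Finset.mem_erase, Finset.mem_Icc, stepUp]
        split_ifs <;> omega⟩
     left_inv := fun a => by
        have := a.bounds
        refine Subtype.ext ?_
        simp only [stepDown, stepUp]
        split_ifs <;> omega
     right_inv := fun a => by
        have := a.bounds
        refine Subtype.ext ?_
        simp only [stepDown, stepUp]
        split_ifs <;> first | contradiction | omega }, fun a => by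
    have := a.bounds
    refine Subtype.ext ?_
    simp only [Equiv.coe_fn_mk, neg_val, stepDown]
    split_ifs <;> omega⟩

/-! ### Entries of signed permutations -/

theorem entry_flagCycle_mul (m : Fin n) (σ : hyperoctahedral n) (i : Fin n) :
    entry (flagCycle m * σ) i = stepDown m (entry σ i) := rfl

theorem entry_one (i : Fin n) : entry (1 : hyperoctahedral n) i = i + 1 := rfl

theorem entry_ne_zero (σ : hyperoctahedral n) (i : Fin n) : entry σ i ≠ 0 := (bounds _).1

theorem entry_inj {σ : hyperoctahedral n} {i j : Fin n} (h : entry σ i = entry σ j) : i = j := by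
  simpa using congrArg idx (σ.1.injective (Subtype.ext h))

theorem entry_inj_neg {σ : hyperoctahedral n} {i j : Fin n} (h : entry σ i = -entry σ j) :
    i = j := by
  have h1 : σ.1 (pos i) = σ.1 (-pos j) := by
    rw [map_neg]
    exact Subtype.ext h
  simpa using congrArg idx (σ.1.injective h1)

theorem entry_abs_inj {σ : hyperoctahedral n} {i j : Fin n}
    (h : |entry σ i| = |entry σ j|) : i = j :=
  (abs_eq_abs.1 h).elim entry_inj entry_inj_neg

theorem exists_abs_entry_eq (σ : hyperoctahedral n) (j : Fin n) :
    ∃ i, |entry σ i| = j + 1 := by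
  obtain ⟨i, hi⟩ := (absPerm σ).surjective j
  refine ⟨i, ?_⟩
  have h := congrArg Fin.val hi
  have h0 := entry_ne_zero σ i
  simp only [absPerm_apply, idx] at h
  change (entry σ i).natAbs - 1 = j.1 at h
  rw [Int.abs_eq_natAbs]
  omega

theorem ext_entry {σ τ : hyperoctahedral n} (h : ∀ i, entry σ i = entry τ i) : σ = τ := by
  refine Subtype.ext (Equiv.ext fun a => ?_)
  rcases eq_pos_or a with ⟨ha, -⟩ | ⟨ha, -⟩
  · rw [ha]
    exact Subtype.ext (h _)
  · rw [ha, map_neg, map_neg]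
    exact congrArg _ (Subtype.ext (h _))

/-! ### Effect of a cycle on the flag-major index -/

/-- The elements of `B_n` fixing the letters `m + 1, …, n`. -/
def FixesFrom (m : ℕ) (σ : hyperoctahedral n) : Prop :=
  ∀ i : Fin n, m ≤ i.1 → entry σ i = i + 1

/-- The absolute values above `m` are already taken at the fixed positions. -/
theorem FixesFrom.abs_entry_le {m : ℕ} {σ : hyperoctahedral n} (h : FixesFrom m σ) {i : Fin n}
    (hi : i.1 < m) : |entry σ i| ≤ m := by
  by_contra! hlt
  have hb := (σ.1 (pos i)).bounds
  change entry σ i ≠ 0 ∧ -(n : ℤ) ≤ entry σ i ∧ entry σ i ≤ n at hb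
  have hle : |entry σ i| ≤ n := abs_le.2 hb.2
  obtain ⟨k, hk⟩ := Int.eq_ofNat_of_zero_le (abs_nonneg (entry σ i))
  have h2 := h ⟨k - 1, by omega⟩ (by simp only; omega)
  have h3 : i = ⟨k - 1, by omega⟩ := entry_abs_inj (σ := σ) (by
    rw [h2, hk, abs_of_nonneg (by positivity)]
    push_cast
    omega)
  have h4 := congrArg Fin.val h3
  simp only at h4
  omega

theorem neg_eq_sum (σ : hyperoctahedral n) :
    (neg σ : ℤ) = ∑ i : Fin n, if entry σ i < 0 then 1 else 0 := by
  rw [neg, Finset.card_filter]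
  push_cast
  rfl

theorem maj_eq_sum (σ : hyperoctahedral n) :
    (maj σ : ℤ) = ∑ i : Fin n,
      if ∃ h : i.1 + 1 < n, flagLT (entry σ ⟨i.1 + 1, h⟩) (entry σ i) then (i : ℤ) + 1 else 0 := by
  rw [maj, Finset.sum_filter]
  push_cast
  rfl

/-- On letters of absolute value at most `m + 1`, `stepDown` moves each letter to its predecessor in
the flag order, except that the minimum `-1` becomes the maximum `m + 1`. If the letter 1 occurs,
all comparisons survive and `neg` grows by 1. If `-1` occurs, `neg` drops by 1 and one descent moves
a place to the right, so `2 maj` grows by 2. The hypothesis `hm` keeps that descent from being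
pushed off the end. -/
theorem FixesFrom.flagMajor_flagCycle_mul {m : Fin n} {σ : hyperoctahedral n}
    (h : FixesFrom (m + 1) σ) (hm : entry σ m ≠ -1) :
    flagMajor (flagCycle m * σ) = flagMajor σ + 1 := by
  obtain ⟨p, hp⟩ := exists_abs_entry_eq σ ⟨0, m.pos⟩
  simp only [Nat.cast_zero, zero_add] at hp
  have hpm : p ≤ m := by
    by_contra! hlt
    have h1 := h p (by omega)
    rw [h1, abs_of_nonneg (by positivity)] at hp
    have : m.1 < p.1 := hlt
    omega
  have hp0 : entry (flagCycle m * σ) p = stepDown m (entry σ p) := rfl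
  -- Away from the position `p` of ±1, signs and relative order are unchanged; these inequalities
  -- let `omega` settle every comparison.
  have hdata : ∀ i : Fin n, i.1 = p.1 ∨ i.1 ≠ p.1 ∧
      ((i.1 ≤ m.1 ∧ 1 < entry σ i ∧ entry σ i ≤ m + 1 ∧
          entry (flagCycle m * σ) i = entry σ i - 1) ∨
        (i.1 ≤ m.1 ∧ entry σ i < -1 ∧ -(m + 1 : ℤ) ≤ entry σ i ∧
          entry (flagCycle m * σ) i = entry σ i + 1) ∨
        (m.1 < i.1 ∧ entry σ i = i + 1 ∧ entry (flagCycle m * σ) i = i + 1)) := fun i => by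
    rcases eq_or_ne i.1 p.1 with hi | hi
    · exact Or.inl hi
    have hne : |entry σ i| ≠ 1 := fun h1 => hi (congrArg Fin.val (entry_abs_inj (h1.trans hp.symm)))
    have h1 : entry σ i ≠ 1 := fun h1 => hne (by simp [h1])
    have h2 : entry σ i ≠ -1 := fun h2 => hne (by simp [h2])
    have h3 := entry_ne_zero σ i
    refine Or.inr ⟨hi, ?_⟩
    rw [entry_flagCycle_mul, stepDown]
    rcases le_or_gt i.1 m.1 with him | him
    · have h4 := abs_le.1 (h.abs_entry_le (Nat.lt_succ_of_le him))
      push_cast at h4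
      split_ifs <;> omega
    · have h4 := h i him
      split_ifs <;> omega
  zify
  simp only [flagMajor]
  push_cast
  rcases (abs_eq zero_le_one).1 hp with hp1 | hp1
  · have hp2 : entry (flagCycle m * σ) p = -(m + 1) := by rw [hp0, hp1, stepDown, if_pos rfl]
    have hneg : (neg (flagCycle m * σ) : ℤ) = neg σ + 1 := by
      have key : ∀ i : Fin n, (if entry (flagCycle m * σ) i < 0 then 1 else 0 : ℤ) =
          (if entry σ i < 0 then 1 else 0) + if i = p then 1 else 0 := fun i => by
        rcases hdata i with hi | ⟨hi, hi'⟩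
        · obtain rfl := Fin.ext hi
          rw [hp1, hp2, if_pos (by omega), if_neg (by omega), if_pos rfl, zero_add]
        · rw [if_neg (fun h => hi (congrArg Fin.val h)), add_zero]
          exact if_congr (by omega) rfl rfl
      rw [neg_eq_sum, neg_eq_sum, Finset.sum_congr rfl fun i _ => key i, Finset.sum_add_distrib]
      simp
    have hmaj : (maj (flagCycle m * σ) : ℤ) = maj σ := by
      rw [maj_eq_sum, maj_eq_sum]
      refine Finset.sum_congr rfl fun i _ => if_congr (exists_congr fun hi => ?_) rfl rfl
      rcases hdata i with h1 | h1 <;> rcases hdata ⟨i + 1, hi⟩ with h2 | h2 <;>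
        simp only at h1 h2
      · omega
      · obtain rfl := Fin.ext h1
        simp only [flagLT]
        omega
      · obtain rfl : ⟨i + 1, hi⟩ = p := Fin.ext h2
        simp only [flagLT]
        omega
      · simp only [flagLT]
        omega
    rw [hneg, hmaj]
    ring
  · have hp2 : entry (flagCycle m * σ) p = m + 1 := by
      rw [hp0, hp1, stepDown, if_neg (by decide), if_pos rfl]
    have hpm : p.1 < m.1 := lt_of_le_of_ne hpm fun h1 => by
      rw [Fin.ext h1] at hp1
      exact hm hp1
    have hneg : (neg (flagCycle m * σ) : ℤ) = neg σ - 1 := by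
      have key : ∀ i : Fin n, (if entry (flagCycle m * σ) i < 0 then 1 else 0 : ℤ) =
          (if entry σ i < 0 then 1 else 0) - if i = p then 1 else 0 := fun i => by
        rcases hdata i with hi | ⟨hi, hi'⟩
        · obtain rfl := Fin.ext hi
          rw [hp1, hp2, if_neg (by omega), if_pos (by omega), if_pos rfl, sub_self]
        · rw [if_neg (fun h => hi (congrArg Fin.val h)), sub_zero]
          exact if_congr (by omega) rfl rfl
      rw [neg_eq_sum, neg_eq_sum, Finset.sum_congr rfl fun i _ => key i, Finset.sum_sub_distrib]
      simp
    -- A minimum at `p` forces a descent just before it and none after; a maximum does the opposite.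
    -- With 0-based `p`, weight `p` is traded for `p + 1`.
    have hmaj : (maj (flagCycle m * σ) : ℤ) = maj σ + 1 := by
      have key : ∀ i : Fin n, (if ∃ h : i.1 + 1 < n, flagLT
            (entry (flagCycle m * σ) ⟨i.1 + 1, h⟩) (entry (flagCycle m * σ) i)
            then (i : ℤ) + 1 else 0) =
          (if ∃ h : i.1 + 1 < n, flagLT (entry σ ⟨i.1 + 1, h⟩) (entry σ i) then (i : ℤ) + 1 else 0)
            + ((if i = p then (p : ℤ) + 1 else 0) - if i.1 + 1 = p.1 then (p : ℤ) else 0) :=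
          fun i => by
        by_cases hi : i.1 + 1 < n
        · simp only [hi, exists_true_left]
          rcases hdata i with h1 | h1 <;> rcases hdata ⟨i + 1, hi⟩ with h2 | h2 <;>
            simp only at h1 h2
          · omega
          · obtain rfl := Fin.ext h1
            rw [if_pos (by rw [flagLT]; omega), if_neg (by rw [flagLT]; omega), if_pos rfl,
              if_neg (by omega)]
            ring
          · obtain rfl : ⟨i + 1, hi⟩ = p := Fin.ext h2
            rw [if_neg (by rw [flagLT]; omega), if_pos (by rw [flagLT]; omega),
              if_neg (by simp [Fin.ext_iff]), if_pos rfl]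
            push_cast
            ring
          · rw [if_neg (fun h => h1.1 (congrArg Fin.val h)), if_neg h2.1, sub_zero, add_zero]
            refine if_congr ?_ rfl rfl
            simp only [flagLT]
            omega
        · rw [if_neg fun h => hi h.1, if_neg fun h => hi h.1, if_neg fun h => by omega,
            if_neg fun h => by omega]
          simp
      -- For `p = 0` no descent is lost, which agrees with the value 0.
      have hshift : ∑ i : Fin n, (if i.1 + 1 = p.1 then (p : ℤ) else 0) = p := by
        rcases Nat.eq_zero_or_pos p.1 with h0 | h0
        · simp [h0]
        · rw [Finset.sum_eq_single ⟨p - 1, by omega⟩, if_pos (by simp only; omega)]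
          · exact fun i _ hi => if_neg fun h => hi (Fin.ext (by simp only; omega))
          · simp
      rw [maj_eq_sum, maj_eq_sum, Finset.sum_congr rfl fun i _ => key i, Finset.sum_add_distrib,
        Finset.sum_sub_distrib, hshift]
      simp
    rw [hneg, hmaj]
    ring

/-! ### Layers indexed by the exponent of the cycle -/

theorem FixesFrom.flagCycle_mul {m : Fin n} {σ : hyperoctahedral n}
    (h : FixesFrom (m + 1) σ) : FixesFrom (m + 1) (flagCycle m * σ) := fun i hi => by
  rw [entry_flagCycle_mul, h i hi, stepDown]
  split_ifs <;> omega

theorem FixesFrom.of_flagCycle_mul {m : Fin n} {σ : hyperoctahedral n}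
    (h : FixesFrom (m + 1) (flagCycle m * σ)) : FixesFrom (m + 1) σ := fun i hi => by
  have h1 := h i hi
  have h2 := entry_ne_zero σ i
  rw [entry_flagCycle_mul, stepDown] at h1
  split_ifs at h1 <;> omega

theorem fixesFrom_succ_and_entry {m : Fin n} {σ : hyperoctahedral n} :
    FixesFrom (m + 1) σ ∧ entry σ m = m + 1 ↔ FixesFrom m σ := by
  refine ⟨fun h i hi => ?_, fun h => ⟨fun i hi => h i (by omega), h m le_rfl⟩⟩
  rcases hi.eq_or_lt with hi | hi
  · rw [← Fin.ext hi]
    exact h.2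
  · exact h.1 i hi

/-- The number of times that `stepDown m` has to be applied to `m + 1` to reach the letter `a`. -/
def depth (m : ℕ) (a : ℤ) : ℕ := if 0 < a then (m + 1 - a).toNat else (a + 2 * m + 2).toNat

theorem FixesFrom.depth_lt {m : Fin n} {σ : hyperoctahedral n} (h : FixesFrom (m + 1) σ) :
    depth m (entry σ m) < 2 * (m + 1) := by
  have h1 := abs_le.1 (h.abs_entry_le (Nat.lt_succ_self _))
  have h2 := entry_ne_zero σ m
  rw [depth]
  split_ifs <;> omega

/-- The bound `hk` excludes the wrap from `-1`, of depth `2m + 1`, to `m + 1`, of depth 0. -/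
theorem FixesFrom.depth_flagCycle_mul {m : Fin n} {σ : hyperoctahedral n}
    (h : FixesFrom (m + 1) σ) {k : ℕ} (hk : k + 1 < 2 * (m + 1)) :
    depth m (entry (flagCycle m * σ) m) = k + 1 ↔ depth m (entry σ m) = k := by
  have h1 := abs_le.1 (h.abs_entry_le (Nat.lt_succ_self _))
  have h2 := entry_ne_zero σ m
  rw [entry_flagCycle_mul, stepDown, depth, depth]
  split_ifs <;> omega

theorem FixesFrom.depth_eq_zero {m : Fin n} {σ : hyperoctahedral n} (h : FixesFrom (m + 1) σ) :
    depth m (entry σ m) = 0 ↔ entry σ m = m + 1 := by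
  have h1 := abs_le.1 (h.abs_entry_le (Nat.lt_succ_self _))
  have h2 := entry_ne_zero σ m
  rw [depth]
  split_ifs <;> omega

theorem fixesFrom_zero {σ : hyperoctahedral n} : FixesFrom 0 σ ↔ σ = 1 :=
  ⟨fun h => ext_entry fun i => h i (Nat.zero_le _), by
    rintro rfl i -
    rfl⟩

theorem fixesFrom_self (σ : hyperoctahedral n) : FixesFrom n σ := fun i hi => by omega

theorem flagMajor_one : flagMajor (1 : hyperoctahedral n) = 0 := by
  have h1 : neg (1 : hyperoctahedral n) = 0 := by
    rw [neg, Finset.filter_false_of_mem, Finset.card_empty]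
    intro i _
    rw [entry_one]
    omega
  have h2 : maj (1 : hyperoctahedral n) = 0 := by
    rw [maj, Finset.filter_false_of_mem, Finset.sum_empty]
    rintro i - ⟨h, hlt⟩
    simp only [entry_one, flagLT] at hlt
    push_cast at hlt
    omega
  rw [flagMajor, h1, h2]

/-! ### Factorization of the twisted generating function -/

variable {R : Type*} [CommRing R]

/-- The signed weight `χ(σ) q ^ fmaj(σ)`. -/
def weight (χ : hyperoctahedral n →* ℤˣ) (q : R) (σ : hyperoctahedral n) : R :=
  ((χ σ : ℤ) : R) * q ^ flagMajor σ

-- Left multiplication by `flagCycle m` is a bijection from the layer of depth `k` to that of depth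
-- `k + 1`, scaling weights by `χ(flagCycle m) q`.
open scoped Classical in
theorem sum_weight_depth (χ : hyperoctahedral n →* ℤˣ) (q : R) (m : Fin n) (k : ℕ)
    (hk : k < 2 * (m + 1)) :
    ∑ σ with FixesFrom (m + 1) σ ∧ depth m (entry σ m) = k, weight χ q σ =
      (((χ (flagCycle m) : ℤ) : R) * q) ^ k * ∑ σ with FixesFrom m σ, weight χ q σ := by
  induction k with
  | zero =>
    rw [pow_zero, one_mul]
    refine Finset.sum_congr (Finset.filter_congr fun σ _ => ?_) fun _ _ => rfl
    rw [← fixesFrom_succ_and_entry]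
    exact and_congr_right fun h => h.depth_eq_zero
  | succ k ih =>
    rw [pow_succ', mul_assoc, ← ih (by omega), Finset.mul_sum]
    symm
    refine Finset.sum_equiv (Equiv.mulLeft (flagCycle m)) (fun σ => ?_) fun σ hσ => ?_
    · simp only [Finset.mem_filter_univ, Equiv.coe_mulLeft]
      exact ⟨fun h => ⟨h.1.flagCycle_mul, (h.1.depth_flagCycle_mul hk).2 h.2⟩,
        fun h => ⟨h.1.of_flagCycle_mul, (h.1.of_flagCycle_mul.depth_flagCycle_mul hk).1 h.2⟩⟩
    · rw [Finset.mem_filter_univ] at hσ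
      have hne : entry σ m ≠ -1 := fun h => by
        have h2 := hσ.2
        rw [h, depth, if_neg (by norm_num)] at h2
        omega
      rw [Equiv.coe_mulLeft, weight, weight, hσ.1.flagMajor_flagCycle_mul hne, map_mul, pow_succ]
      push_cast
      ring

open scoped Classical in
theorem sum_weight_fixesFrom (χ : hyperoctahedral n →* ℤˣ) (q : R) (c : ℕ → ℤ)
    (hc : ∀ m : Fin n, (χ (flagCycle m) : ℤ) = c m) (m : ℕ) (hm : m ≤ n) :
    ∑ σ with FixesFrom m σ, weight χ q σ =
      ∏ j ∈ Finset.range m, ∑ k ∈ Finset.range (2 * (j + 1)), ((c j : R) * q) ^ k := by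
  induction m with
  | zero => simp [fixesFrom_zero, Finset.filter_eq', weight, flagMajor_one]
  | succ m ih =>
    -- Split the elements fixing the letters above `m + 1` by the depth of their last free entry.
    rw [Finset.prod_range_succ, ← ih (by omega), mul_comm, Finset.sum_mul,
      ← Finset.sum_fiberwise_of_maps_to (t := Finset.range (2 * (m + 1)))
        (g := fun σ => depth m (entry σ ⟨m, hm⟩))]
    · refine Finset.sum_congr rfl fun k hk => ?_
      rw [Finset.filter_filter, ← hc ⟨m, hm⟩]
      exact sum_weight_depth χ q ⟨m, hm⟩ k (Finset.mem_range.1 hk)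
    · intro σ hσ
      rw [Finset.mem_filter_univ] at hσ
      exact Finset.mem_range.2 (FixesFrom.depth_lt (m := ⟨m, hm⟩) hσ)

theorem sum_weight [Fintype (hyperoctahedral n)] (χ : hyperoctahedral n →* ℤˣ) (q : R) (c : ℕ → ℤ)
    (hc : ∀ m : Fin n, (χ (flagCycle m) : ℤ) = c m) :
    ∑ σ, weight χ q σ =
      ∏ j ∈ Finset.range n, ∑ k ∈ Finset.range (2 * (j + 1)), ((c j : R) * q) ^ k := by
  classical
  rw [← sum_weight_fixesFrom χ q c hc n le_rfl, Finset.filter_true_of_mem fun σ _ =>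
    fixesFrom_self σ]
  congr!

/-! ### Characters on the cycles, and sums over their kernels -/

theorem sign_absPerm_flagCycle (m : Fin n) :
    Equiv.Perm.sign (absPerm (flagCycle m)) = (-1) ^ m.1 := by
  obtain ⟨k, rfl⟩ := Nat.exists_eq_succ_of_ne_zero m.pos.ne'
  have h : absPerm (flagCycle m) = (Fin.cycleRange m)⁻¹ := by
    rw [eq_inv_iff_mul_eq_one]
    refine Equiv.ext fun i => Fin.ext ?_
    have hv (j : Fin (k + 1)) :
        (absPerm (flagCycle m) j).1 = (stepDown m (j + 1)).natAbs - 1 := rfl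
    rw [Equiv.Perm.mul_apply, Equiv.Perm.one_apply, hv, stepDown]
    rcases le_or_gt i m with him | him
    · have him' : i.1 ≤ m.1 := him
      rw [Fin.coe_cycleRange_of_le him]
      rcases eq_or_ne i m with rfl | hne
      · rw [if_pos rfl, if_pos (by simp)]
        omega
      · have := Fin.val_ne_of_ne hne
        rw [if_neg hne]
        push_cast
        split_ifs <;> omega
    · have him' : m.1 < i.1 := him
      rw [Fin.cycleRange_of_gt him]
      split_ifs <;> omega
  rw [h, Equiv.Perm.sign_inv, Fin.sign_cycleRange]

theorem negChar_flagCycle (m : Fin n) : negChar (flagCycle m) = -1 := by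
  have h : (neg (flagCycle m) : ℤ) = 1 := by
    have key : ∀ i : Fin n, (if entry (flagCycle m) i < 0 then 1 else 0 : ℤ) =
        if i = ⟨0, m.pos⟩ then 1 else 0 := fun i => by
      have hi : entry (flagCycle m) i = stepDown m (i + 1) := rfl
      refine if_congr ?_ rfl rfl
      rw [hi, stepDown, Fin.ext_iff]
      split_ifs <;> simp only <;> omega
    rw [neg_eq_sum, Finset.sum_congr rfl fun i _ => key i]
    simp
  rw [negChar_apply, Nat.cast_eq_one.1 h, pow_one]

/-- The indicator of the kernel `H` is `(1 + χ) / 2`. The conditions `hq` and `hq1` are needed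
because `qInt` at 1 is `0 / 0 = 0`, not a geometric sum. -/
theorem sum_subgroup_weight {K : Type*} [Field K] [CharZero K] (H : Subgroup (hyperoctahedral n))
    [Fintype H] (χ : hyperoctahedral n →* ℤˣ) (hχ : ∀ σ, σ ∈ H ↔ χ σ = 1) (q : K) (c : ℕ → ℤ)
    (hc : ∀ m : Fin n, (χ (flagCycle m) : ℤ) = c m) (hq : ∀ j, (c j : K) * q ≠ 1) (hq1 : q ≠ 1) :
    ∑ σ : H, q ^ flagMajor σ.1 =
      1 / 2 * (∏ i ∈ Finset.Icc 1 n, qInt (2 * i) q +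
        ∏ i ∈ Finset.Icc 1 n, qInt (2 * i) ((c (i - 1) : K) * q)) := by
  classical
  have hprod : ∀ d : ℕ → ℤ, (∀ j, (d j : K) * q ≠ 1) →
      ∏ i ∈ Finset.Icc 1 n, qInt (2 * i) ((d (i - 1) : K) * q) =
        ∏ j ∈ Finset.range n, ∑ k ∈ Finset.range (2 * (j + 1)), ((d j : K) * q) ^ k := by
    intro d hd
    rw [← Finset.Ico_succ_right_eq_Icc, Finset.prod_Ico_eq_prod_range]
    refine Finset.prod_congr (by simp) fun j _ => ?_
    rw [geom_sum_eq (hd _), qInt, ← neg_div_neg_eq, neg_sub, neg_sub, add_comm 1 j]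
    simp
  have h1 : ∏ i ∈ Finset.Icc 1 n, qInt (2 * i) q = ∑ σ, weight (n := n) 1 q σ := by
    rw [sum_weight 1 q (fun _ => 1) (by simp), ← hprod (fun _ => 1) (by simpa using hq1)]
    simp
  rw [h1, hprod c hq, ← sum_weight χ q c hc, ← Finset.sum_add_distrib, Finset.mul_sum]
  rw [← Finset.sum_subtype (Finset.univ.filter (· ∈ H)) (by simp)
    (fun σ => q ^ flagMajor σ), Finset.sum_filter]
  refine Finset.sum_congr rfl fun σ _ => ?_
  rcases Int.units_eq_one_or (χ σ) with h | h
  · rw [if_pos ((hχ σ).2 h)]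
    simp [weight, h]
    ring
  · rw [if_neg fun hm => by simp [(hχ σ).1 hm] at h]
    simp [weight, h]

end hyperoctahedral

-- Otherwise the polynomial `X` would be a constant.
open hyperoctahedral RatFunc in
theorem RatFunc.neg_one_pow_mul_X_ne_one (e : ℕ) : (-1) ^ e * (X : RatFunc ℚ) ≠ 1 := by
  have h : Polynomial.X ≠ Polynomial.C ((-1 : ℚ) ^ e) := fun h => by
    simpa using congrArg Polynomial.natDegree h
  intro h1
  refine h (RatFunc.algebraMap_injective ℚ ?_)
  rw [algebraMap_X, algebraMap_C, map_pow, _root_.map_neg, map_one]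
  calc (X : RatFunc ℚ) = (-1) ^ e * ((-1) ^ e * X) := by simp [← mul_assoc, ← mul_pow]
    _ = (-1) ^ e := by rw [h1, mul_one]

open hyperoctahedral RatFunc in
open scoped Classical in
theorem corollaryt (n : ℕ) :
    (∑ σ : evenSubgroup n, (X : RatFunc ℚ) ^ flagMajor σ.1 =
      1 / 2 * (∏ i ∈ Finset.Icc 1 n, qInt (2 * i) X +
        ∏ i ∈ Finset.Icc 1 n, qInt (2 * i) ((-1) ^ i * X))) ∧
    (∑ σ : typeD n, (X : RatFunc ℚ) ^ flagMajor σ.1 =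
      1 / 2 * (∏ i ∈ Finset.Icc 1 n, qInt (2 * i) X +
        ∏ i ∈ Finset.Icc 1 n, qInt (2 * i) (-X))) ∧
    (∑ σ : wreathAlternating n, (X : RatFunc ℚ) ^ flagMajor σ.1 =
      1 / 2 * (∏ i ∈ Finset.Icc 1 n, qInt (2 * i) X +
        ∏ i ∈ Finset.Icc 1 n, qInt (2 * i) ((-1) ^ (i - 1) * X))) := by
  have hX := RatFunc.neg_one_pow_mul_X_ne_one
  have hX1 : (X : RatFunc ℚ) ≠ 1 := by simpa using hX 0
  refine ⟨?_, ?_, ?_⟩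
  -- The parity of the length is the product of the other two characters, hence `(-1)^j * (-1)` on
  -- the cycle of index `j = i - 1`.
  · rw [sum_subgroup_weight _ (Equiv.Perm.sign.comp absPerm * negChar) (fun σ => ?_) X
      (fun j => (-1) ^ (j + 1)) (fun m => ?_) (fun j => ?_) hX1]
    · congr 2
      refine Finset.prod_congr rfl fun i hi => ?_
      rw [Nat.sub_add_cancel (Finset.mem_Icc.1 hi).1]
      push_cast
      rfl
    · rw [MonoidHom.mul_apply, MonoidHom.comp_apply, ← neg_one_pow_length, ← even_iff_neg_one_pow]
      rfl
    · simp [sign_absPerm_flagCycle, negChar_flagCycle, pow_succ]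
    · exact_mod_cast hX (j + 1)
  · rw [sum_subgroup_weight _ negChar (fun σ => ?_) X
      (fun j => -1) (fun m => ?_) (fun j => ?_) hX1]
    · simp
    · rw [negChar_apply, ← even_iff_neg_one_pow]
      rfl
    · simp [negChar_flagCycle]
    · simpa using hX 1
  · rw [sum_subgroup_weight _ (Equiv.Perm.sign.comp absPerm) (fun σ => ?_) X
      (fun j => (-1) ^ j) (fun m => ?_) (fun j => ?_) hX1]
    · push_cast
      rfl
    · rfl
    · simp [sign_absPerm_flagCycle]
    · exact_mod_cast hX j
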